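/- **Setup.** Let $m,n\ge 1$, $S^1=\mathbb R/\mathbb Z$. Let $(\Sigma,\omega_0)$ be a compact symplectic surface, possibly with boundary, $0<\epsilon<\tfrac12$, and $N\subset\Sigma$ an open tubular neighbourhood of a simple closed curve with coordinates $(x,y)\in(-\epsilon,1+\epsilon)\times S^1$ in which $\omega_0=dx\wedge dy$. Put $N'=[\epsilon,1-\epsilon]\times S^1\subset N$, $\Sigma_0=\Sigma\setminus N'$, and let $H_0:\Sigma_0\to\mathbb R$ be smooth with $H_0=\tfrac12x^2$ on $(-\epsilon,\epsilon)\times S^1$ and $H_0=\tfrac12(x-1)^2$ on $(1-\epsilon,1+\epsilon)\times S^1$. Let $(B_0,j_0)$ be the thrice punctured sphere. Either the first two punctures are called positive and the third negative (the bundle $X_{m,n}$), or the first two negative and the third positive (the bundle $X^{m,n}$). Near each puncture fix conformal cylindrical coordinates $(s_i,t_i)$, $t_i\in S^1$, with $s_i\in[0,\infty)$ at positive and $s_i\in(-\infty,0]$ at negative punctures, and fix a smooth $g:B_0\to S^1$ such that $\beta:=dg$ equals $m\,dt_1$, $n\,dt_2$, $(m+n)\,dt_3$ near the first, second and third puncture.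 Let $X_D=B_0\times N$, $X_H=B_0\times\Sigma_0$, and let $X=(X_D\sqcup X_H)/\!\sim$, where $(b,x,y)\in X_D$ is identified with $(b,x,y)\in X_H$ for $|x|<\epsilon$, and with $(b,x,y+g(b))\in X_H$ for $|x-1|<\epsilon$. Let $\pi:X\to B_0$ be the projection. Let $0<\delta<\epsilon$. The *unperturbed range* is the set of $x\in(-\epsilon,1+\epsilon)$ with $|x-x_0|\ge\delta$ for all $x_0\in(-\epsilon,1+\epsilon)$ such that one of $mx_0,nx_0,(m+n)x_0$ is an integer. Let $\kappa$ be a smooth one-form on $X$ vanishing on $\ker d\pi$, whose support is contained in the part of $X_D$ where $x$ is not in the unperturbed range, and let $\omega_X$ be the closed two-form that equals $dx\wedge dy+d(\tfrac12x^2\beta+\kappa)$ on $X_D$ and $\omega_0+d(H_0\beta+\kappa)$ on $X_H$. Let $\mathrm{Ver}=\ker d\pi$ and let $\mathrm{Hor}$ be its $\omega_X$-orthogonal complement. A smooth almost complex structure $J$ on $X$ is *fibration-compatible* if $d\pi\circ J=j_0\circ d\pi$, $J$ is tamed by $\omega_X$ on each fibre of $\pi$, and $J(\mathrm{Hor})\subset\mathrm{Hor}$.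 A smooth section $u:B_0\to X$ is *$J$-holomorphic* if $du\circ j_0=J\circ du$ and *horizontal* if $du(TB_0)\subset\mathrm{Hor}$. For $x\in(-\epsilon,1+\epsilon)$ let $F_x=B_0\times\{x\}\times S^1\subset X_D$. Identify $(p,q_1,q_2)\in\mathbb Z^3$ with $p[S^1_y]+q_1[S^1_{t_1}]+q_2[S^1_{t_2}]\in H_1(X_D;\mathbb Z)$. **Lemma.** Let $J$ be fibration-compatible and let $C$ be the image of a $J$-holomorphic section $u:B_0\to X$ that is not horizontal. Let $x$ be in the unperturbed range, and assume that $C$ intersects $F_x$ transversely and that $C\cap F_x$ is non-empty and a finite union of circles. Orient each circle as part of the boundary of $C\cap F_{[x-\epsilon',x]}$, where $F_{[x-\epsilon',x]}=B_0\times[x-\epsilon',x]\times S^1$ with $\epsilon'>0$ small and $C$ carries the orientation induced by $j_0$. If $(p,q_1,q_2)$ is the homology class of $C\cap F_x$ in $H_1(X_D;\mathbb Z)$, then $$p+x(mq_1+nq_2)>0 .$$ -/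

import Mathlib

open Set Filter Topology
open scoped Manifold ContDiff

noncomputable section

/-! ### First singular homology -/

namespace SingularH1

/-- Singular `n`-simplices in `Y`. -/
abbrev Simplex (n : ℕ) (Y : Type*) [TopologicalSpace Y] : Type _ :=
  C(stdSimplex ℝ (Fin (n + 1)), Y)

/-- Singular `n`-chains with integer coefficients. -/
abbrev Chain (n : ℕ) (Y : Type*) [TopologicalSpace Y] : Type _ := Simplex n Y →₀ ℤ

/-- The inclusion of the `i`-th face (the one opposite to the vertex `i`). -/
def face (n : ℕ) (i : Fin (n + 2)) :
    C(stdSimplex ℝ (Fin (n + 1)), stdSimplex ℝ (Fin (n + 2))) :=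
  ⟨stdSimplex.map i.succAbove, stdSimplex.continuous_map _⟩

/-- The singular boundary operator `∂ σ = ∑ (-1)^i σ|_{i-th face}`. -/
def boundary (n : ℕ) (Y : Type*) [TopologicalSpace Y] : Chain (n + 1) Y →+ Chain n Y :=
  Finsupp.liftAddHom fun σ =>
    (zmultiplesHom (Chain n Y))
      (∑ i : Fin (n + 2), Finsupp.single (σ.comp (face n i)) ((-1 : ℤ) ^ (i : ℕ)))

/-- `H_1(Y; ℤ)`: singular 1-cycles modulo singular boundaries. -/
abbrev H1 (Y : Type*) [TopologicalSpace Y] : Type _ :=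
  (boundary 0 Y).ker ⧸ (boundary 1 Y).range.addSubgroupOf (boundary 0 Y).ker

variable {Y : Type*} [TopologicalSpace Y]

/-- A path, viewed as a singular 1-simplex. -/
def pathSimplex (c : C(unitInterval, Y)) : Simplex 1 Y :=
  c.comp ⟨stdSimplexHomeomorphUnitInterval, stdSimplexHomeomorphUnitInterval.continuous⟩

theorem boundary_loop (c : C(unitInterval, Y)) (h : c 0 = c 1) :
    boundary 0 Y (Finsupp.single (pathSimplex c) 1) = 0 := by
  have key : ∀ i : Fin 2, (pathSimplex c).comp (face 0 i) = ContinuousMap.const _ (c 0) := by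
    intro i
    ext s
    have hs : s = stdSimplex.vertex (S := ℝ) (0 : Fin 1) := Subsingleton.elim _ _
    subst hs
    simp only [pathSimplex, face, ContinuousMap.comp_apply, ContinuousMap.coe_mk,
      stdSimplex.map_vertex, ContinuousMap.const_apply]
    fin_cases i
    · exact h.symm
    · rfl
  simp [boundary, key, Fin.sum_univ_two]

/-- The homology class of a closed path. -/
def loopClass (c : C(unitInterval, Y)) (h : c 0 = c 1) : H1 Y :=
  QuotientAddGroup.mk ⟨Finsupp.single (pathSimplex c) 1, boundary_loop c h⟩

end SingularH1

namespace DehnCobordism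

/-! ### The base: the thrice punctured sphere -/

/-- The thrice punctured sphere with its complex structure. By the uniformization theorem and the
threefold transitivity of Möbius transformations, the first, second and third puncture are taken
to be `0`, `1` and `∞`. -/
def B0set : Set ℂ := {z | z ≠ 0 ∧ z ≠ 1}

/-- The thrice punctured sphere as a type. -/
abbrev B0 : Type := B0set

/-- The two fibre bundles: `product` is `X_{m,n}` (punctures 1 and 2 positive, puncture 3 negative),
`coproduct` is `X^{m,n}` (puncture 3 positive, punctures 1 and 2 negative). -/
inductive Kind
  | product
  | coproduct

/-- The sign of the first two punctures; the third puncture has the opposite sign. -/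
def Kind.sign : Kind → ℝ
  | .product => 1
  | .coproduct => -1

/-- The embedding `θ ↦ exp (2 π i θ)` of `ℝ/ℤ` in `ℂ`. -/
def circleExp (θ : UnitAddCircle) : ℂ := (AddCircle.toCircle θ : ℂ)

/-- The real-valued differential `df` of a smooth map `f : ℂ → ℝ/ℤ`:
if `G = exp (2 π i f)` then `df = Im (conj G * dG) / (2 π)`. -/
def circleForm (f : ℂ → UnitAddCircle) (z : ℂ) : ℂ →L[ℝ] ℝ :=
  (1 / (2 * Real.pi)) •
    Complex.imCLM.comp
      ((starRingEnd ℂ) (circleExp (f z)) • fderiv ℝ (fun z' => circleExp (f z')) z)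

/-- `c` parametrizes, by the closed unit disc, a neighbourhood of the puncture `c 0`
holomorphically and injectively. -/
structure IsDisc (c : ℂ → ℂ) (a : ℂ) : Prop where
  analytic : AnalyticOnNhd ℂ c (Metric.closedBall 0 1)
  inj : InjOn c (Metric.closedBall 0 1)
  center : c 0 = a

/-- Let `e` be a parametrization of a punctured neighbourhood of a puncture of sign `s = ± 1` by
the punctured unit disc. The conformal cylindrical coordinates `(σ, t)` (with `0 ≤ σ` if `s = 1`
and `σ ≤ 0` if `s = -1`) are given by `w = exp (-2 π s (σ + i t))`, so that
`dt = - s Im (dw / w) / (2 π)`. The condition says that `β = k dt` near the puncture. -/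
def EqualsMulDtNear (β : ℂ → ℂ →L[ℝ] ℝ) (e : ℂ → ℂ) (s : ℝ) (k : ℕ) : Prop :=
  ∀ᶠ w in 𝓝[≠] (0 : ℂ), ∀ v : ℂ,
    β (e w) (deriv e w * v) = k * (-s * (v / w).im / (2 * Real.pi))

/-- The data chosen on the base: conformal cylindrical coordinates near the three punctures, and a
smooth map `g : B_0 → ℝ/ℤ` with `dg = m dt_1`, `dg = n dt_2`, `dg = (m + n) dt_3` near them. -/
structure Base (kind : Kind) (m n : ℕ) where
  /-- holomorphic discs around the punctures; the third one is in the coordinate `1 / z` -/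
  c₁ : ℂ → ℂ
  c₂ : ℂ → ℂ
  c₃ : ℂ → ℂ
  disc₁ : IsDisc c₁ 0
  disc₂ : IsDisc c₂ 1
  disc₃ : IsDisc c₃ 0
  mem₁ : ∀ w, w ≠ 0 → ‖w‖ ≤ 1 → c₁ w ∈ B0set
  mem₂ : ∀ w, w ≠ 0 → ‖w‖ ≤ 1 → c₂ w ∈ B0set
  mem₃ : ∀ w, w ≠ 0 → ‖w‖ ≤ 1 → (c₃ w)⁻¹ ∈ B0set
  g : ℂ → UnitAddCircle
  g_smooth : ContDiffOn ℝ ∞ (fun z => circleExp (g z)) B0set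
  near₁ : EqualsMulDtNear (circleForm g) c₁ kind.sign m
  near₂ : EqualsMulDtNear (circleForm g) c₂ kind.sign n
  near₃ : EqualsMulDtNear (circleForm g) (fun w => (c₃ w)⁻¹) (-kind.sign) (m + n)

/-- The closed one-form `β = dg`. -/
def Base.β {kind : Kind} {m n : ℕ} (B : Base kind m n) : ℂ → ℂ →L[ℝ] ℝ := circleForm B.g

/-! ### The fibre: a symplectic surface with a twist region -/

/-- The model space of the tangent spaces of the surface. -/
abbrev E2 : Type := EuclideanSpace ℝ (Fin 2)

/-- The model with corners of `ℂ × S` for a surface `S` with (possibly empty) boundary. -/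
abbrev IX : ModelWithCorners ℝ (ℂ × E2) (ModelProd ℂ (EuclideanHalfSpace 2)) :=
  𝓘(ℝ, ℂ).prod (𝓡∂ 2)

/-- The universal covering `ℂ × ℝ × ℝ → ℂ × ℝ × ℝ/ℤ`. -/
def cov (P : ℂ × ℝ × ℝ) : ℂ × ℝ × UnitAddCircle := (P.1, P.2.1, (P.2.2 : UnitAddCircle))

/-- A symplectic form `area` on the surface `S`, a tubular neighbourhood
`N = ν ((-ε, 1 + ε) × ℝ/ℤ)` of a simple closed curve in which `area = dx ∧ dy`, and a Hamiltonian `H`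
which is `x² / 2` and `(x - 1)² / 2` in the two components of `N \ N'`,
where `N' = ν ([ε, 1 - ε] × ℝ/ℤ)`. Only the values of `H` off `N'` matter. -/
structure TwistSurface (S : Type*) [TopologicalSpace S] [ChartedSpace (EuclideanHalfSpace 2) S]
    [IsManifold (𝓡∂ 2) ∞ S] where
  area : ∀ q : S, TangentSpace (𝓡∂ 2) q →L[ℝ] TangentSpace (𝓡∂ 2) q →L[ℝ] ℝ
  area_smooth : ContMDiff (𝓡∂ 2) ((𝓡∂ 2).prod 𝓘(ℝ, E2 →L[ℝ] E2 →L[ℝ] ℝ)) ∞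
    (fun q => Bundle.TotalSpace.mk' (E2 →L[ℝ] E2 →L[ℝ] ℝ)
      (E := fun q : S => TangentSpace (𝓡∂ 2) q →L[ℝ] TangentSpace (𝓡∂ 2) q →L[ℝ] ℝ) q (area q))
  area_alt : ∀ q v, area q v v = 0
  area_nondeg : ∀ q v, v ≠ 0 → ∃ w, area q v w ≠ 0
  ε : ℝ
  ε_pos : 0 < ε
  ε_lt : ε < 1 / 2
  ν : ℝ × UnitAddCircle → S
  ν_smooth : ContMDiffOn 𝓘(ℝ, ℝ × ℝ) (𝓡∂ 2) ∞
    (fun P : ℝ × ℝ => ν (P.1, (P.2 : UnitAddCircle))) (Ioo (-ε) (1 + ε) ×ˢ univ)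
  ν_inj : InjOn ν (Ioo (-ε) (1 + ε) ×ˢ univ)
  ν_open : IsOpen (ν '' (Ioo (-ε) (1 + ε) ×ˢ univ))
  ν_symp : ∀ P : ℝ × ℝ, P.1 ∈ Ioo (-ε) (1 + ε) → ∀ V W : ℝ × ℝ,
    area (ν (P.1, (P.2 : UnitAddCircle)))
      (mfderiv 𝓘(ℝ, ℝ × ℝ) (𝓡∂ 2) (fun P : ℝ × ℝ => ν (P.1, (P.2 : UnitAddCircle))) P V)
      (mfderiv 𝓘(ℝ, ℝ × ℝ) (𝓡∂ 2) (fun P : ℝ × ℝ => ν (P.1, (P.2 : UnitAddCircle))) P W)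
      = V.1 * W.2 - V.2 * W.1
  H : S → ℝ
  H_smooth : ContMDiffOn (𝓡∂ 2) 𝓘(ℝ, ℝ) ∞ H (ν '' (Icc ε (1 - ε) ×ˢ univ))ᶜ
  H_left : ∀ (x : ℝ) (y : UnitAddCircle), x ∈ Ioo (-ε) ε → H (ν (x, y)) = x ^ 2 / 2
  H_right : ∀ (x : ℝ) (y : UnitAddCircle), x ∈ Ioo (1 - ε) (1 + ε) →
    H (ν (x, y)) = (x - 1) ^ 2 / 2

section Bundle

variable {S : Type*} [TopologicalSpace S] [ChartedSpace (EuclideanHalfSpace 2) S]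
  [IsManifold (𝓡∂ 2) ∞ S] {kind : Kind} {m n : ℕ}

/-- The tubular neighbourhood `N` as a subset of the surface. -/
def TwistSurface.N (T : TwistSurface S) : Set S := T.ν '' (Ioo (-T.ε) (1 + T.ε) ×ˢ univ)

/-- The complement `Σ_0` of `N'`. -/
def TwistSurface.outer (T : TwistSurface S) : Set S :=
  (T.ν '' (Icc T.ε (1 - T.ε) ×ˢ univ))ᶜ

/-! ### The total space `X = X_D ∪ X_H` -/

/-- `X_D = B_0 × (-ε, 1 + ε) × ℝ/ℤ`. -/
def TwistSurface.DSet (T : TwistSurface S) : Set (ℂ × ℝ × UnitAddCircle) :=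
  {P | P.1 ∈ B0set ∧ P.2.1 ∈ Ioo (-T.ε) (1 + T.ε)}

/-- `X_H = B_0 × Σ_0`. -/
def TwistSurface.HSet (T : TwistSurface S) : Set (ℂ × S) := {P | P.1 ∈ B0set ∧ P.2 ∈ T.outer}

/-- The part of `X_D` that is glued to `X_H`. -/
def TwistSurface.overlap (T : TwistSurface S) : Set (ℂ × ℝ × UnitAddCircle) :=
  {P | P ∈ T.DSet ∧ (P.2.1 < T.ε ∨ 1 - T.ε < P.2.1)}

/-- The gluing map, `(p, x, y) ↦ (p, x, y)` on the left end and `(p, x, y) ↦ (p, x, y + g p)` on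
the right end, in the coordinates of `N ⊆ S`. -/
def glue (B : Base kind m n) (T : TwistSurface S) (P : ℂ × ℝ × UnitAddCircle) : ℂ × S :=
  (P.1, T.ν (P.2.1, P.2.2 + if P.2.1 < 1 / 2 then 0 else B.g P.1))

theorem glue_injOn (B : Base kind m n) (T : TwistSurface S) : InjOn (glue B T) T.DSet := by
  rintro ⟨z, x, y⟩ ⟨-, hx⟩ ⟨z', x', y'⟩ ⟨-, hx'⟩ h
  simp only [glue, Prod.mk.injEq] at h
  obtain ⟨rfl, h⟩ := h
  have key : ∀ {a b : ℝ × UnitAddCircle}, T.ν a = T.ν b → a.1 ∈ Ioo (-T.ε) (1 + T.ε) →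
      b.1 ∈ Ioo (-T.ε) (1 + T.ε) → a = b :=
    fun hab ha hb => T.ν_inj ⟨ha, mem_univ _⟩ ⟨hb, mem_univ _⟩ hab
  have := key h hx hx'
  simp only [Prod.mk.injEq] at this
  obtain ⟨rfl, h2⟩ := this
  simpa using h2

/-- The relation `∼` on the disjoint union of `X_D` and `X_H`. -/
def GlueRel (B : Base kind m n) (T : TwistSurface S) : T.DSet ⊕ T.HSet → T.DSet ⊕ T.HSet → Prop
  | .inl P, .inl Q => P = Q
  | .inr P, .inr Q => P = Q
  | .inl P, .inr Q => P.1 ∈ T.overlap ∧ glue B T P.1 = Q.1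
  | .inr Q, .inl P => P.1 ∈ T.overlap ∧ glue B T P.1 = Q.1

/-- `∼` as an equivalence relation. -/
def glueSetoid (B : Base kind m n) (T : TwistSurface S) : Setoid (T.DSet ⊕ T.HSet) where
  r := GlueRel B T
  iseqv :=
    { refl := by rintro (P | P) <;> rfl
      symm := by
        rintro (P | P) (Q | Q) h
        · exact Eq.symm h
        · exact h
        · exact h
        · exact Eq.symm h
      trans := by
        rintro (P | P) (Q | Q) (R | R) h k
        · exact Eq.trans h k
        · cases h; exact k
        · exact Subtype.ext (glue_injOn B T P.2 R.2 (h.2.trans k.2.symm))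
        · cases k; exact h
        · cases k; exact h
        · exact Subtype.ext (h.2.symm.trans k.2)
        · cases h; exact k
        · exact Eq.trans h k }

/-- The total space `X = (X_D ⊔ X_H) / ∼`. Its smooth structure is the one for which the inclusions
of `X_D` and `X_H` are diffeomorphisms onto open subsets. Accordingly, tensor fields on `X` are
given below by their restrictions to `X_D` and `X_H`, which have to correspond to each other under
the gluing map, and smoothness of maps to or from `X` is tested on these two pieces. -/
def TotalX (B : Base kind m n) (T : TwistSurface S) : Type _ := Quotient (glueSetoid B T)

/-- The inclusion of `X_D`. -/
def inD (B : Base kind m n) (T : TwistSurface S) (P : T.DSet) : TotalX B T :=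
  Quotient.mk (glueSetoid B T) (.inl P)

/-- The inclusion of `X_H`. -/
def inH (B : Base kind m n) (T : TwistSurface S) (P : T.HSet) : TotalX B T :=
  Quotient.mk (glueSetoid B T) (.inr P)

/-- The bundle projection `π : X → B_0`. -/
def proj (B : Base kind m n) (T : TwistSurface S) : TotalX B T → B0 :=
  Quotient.lift
    (fun P : T.DSet ⊕ T.HSet =>
      match P with
      | .inl P => (⟨P.1.1, P.2.1⟩ : B0)
      | .inr P => (⟨P.1.1, P.2.1⟩ : B0))
    (by
      rintro (P | P) (Q | Q) h
      · cases (show P = Q from h); rfl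
      · exact Subtype.ext (congrArg Prod.fst (show glue B T P.1 = Q.1 from h.2))
      · exact Subtype.ext (congrArg Prod.fst (show glue B T Q.1 = P.1 from h.2)).symm
      · cases (show P = Q from h); rfl)

/-- The slice `F_x = B_0 × {x} × ℝ/ℤ ⊆ X_D ⊆ X`. -/
def slice (B : Base kind m n) (T : TwistSurface S) (x : ℝ) : Set (TotalX B T) :=
  {Q | ∃ P : T.DSet, P.1.2.1 = x ∧ inD B T P = Q}

/-! ### The fibrewise symplectic form -/

/-- The `x`-coordinates in the twist region of the Morse-Bott circles of Reeb orbits of the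
mapping tori of the iterates `m`, `n`, `m + n` of the unperturbed twist. -/
def morseBott (T : TwistSurface S) (m n : ℕ) : Set ℝ :=
  {x | x ∈ Ioo (-T.ε) (1 + T.ε) ∧
    ∃ k : ℤ, m * x = k ∨ n * x = k ∨ ((m + n : ℕ) : ℝ) * x = k}

/-- The unperturbed range. -/
def unperturbed (T : TwistSurface S) (m n : ℕ) (δ : ℝ) : Set ℝ :=
  {x | x ∈ Ioo (-T.ε) (1 + T.ε) ∧ ∀ x₀ ∈ morseBott T m n, δ ≤ |x - x₀|}

/-- A Hamiltonian perturbation: a smooth horizontal one-form `κ` on `X` (a one-form that vanishes on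
vertical vectors, i.e. a function with values in the cotangent spaces of `B_0`), whose support is
contained in the part of `X_D` with `|x - x₀| < δ` for some Morse-Bott coordinate `x₀`. -/
structure Perturbation (B : Base kind m n) (T : TwistSurface S) where
  δ : ℝ
  δ_pos : 0 < δ
  δ_lt : δ < T.ε
  D : ℂ × ℝ × UnitAddCircle → ℂ →L[ℝ] ℝ
  H : ℂ × S → ℂ →L[ℝ] ℝ
  match_overlap : ∀ P ∈ T.overlap, H (glue B T P) = D P
  D_smooth : ContDiffOn ℝ ∞ (fun P => D (cov P)) (cov ⁻¹' T.DSet)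
  H_smooth : ContMDiffOn IX 𝓘(ℝ, ℂ →L[ℝ] ℝ) ∞ H T.HSet
  D_supp : ∀ P : ℂ × ℝ × ℝ, P.1 ∈ B0set → P.2.1 ∈ unperturbed T m n δ →
    ∀ᶠ Q in 𝓝 P, D (cov Q) = 0
  H_supp : ∀ P ∈ T.HSet, P.2 ∉ T.N → ∀ᶠ Q in 𝓝 P, H Q = 0

variable {B : Base kind m n} {T : TwistSurface S}

/-- The horizontal one-form `x² / 2 β + κ` on `X_D`. -/
def potD (K : Perturbation B T) (P : ℂ × ℝ × ℝ) : ℂ →L[ℝ] ℝ :=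
  (P.2.1 ^ 2 / 2) • B.β P.1 + K.D (cov P)

/-- The fibrewise symplectic form `ω_X = dx ∧ dy + d (x² / 2 β + κ)` on `X_D`. Note that
`dσ (V, W) = (∂_V σ) W - (∂_W σ) V`, and that a horizontal one-form only sees the
first components of the tangent vectors. -/
def omegaD (K : Perturbation B T) (P V W : ℂ × ℝ × ℝ) : ℝ :=
  (V.2.1 * W.2.2 - V.2.2 * W.2.1)
    + (fderiv ℝ (potD K) P V W.1 - fderiv ℝ (potD K) P W V.1)

/-- The horizontal one-form `H β + κ` on `X_H`. -/
def potH (K : Perturbation B T) (P : ℂ × S) : ℂ →L[ℝ] ℝ := T.H P.2 • B.β P.1 + K.H P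

/-- The base component of a tangent vector of `ℂ × S`. -/
def basePart {P : ℂ × S} (V : TangentSpace IX P) : ℂ := (show ℂ × E2 from V).1

/-- The fibre component of a tangent vector of `ℂ × S`. -/
def fibrePart {P : ℂ × S} (V : TangentSpace IX P) : TangentSpace (𝓡∂ 2) P.2 :=
  (show ℂ × E2 from V).2

/-- The derivative of the horizontal one-form on `X_H` in the direction `V`. -/
def dpotH (K : Perturbation B T) (P : ℂ × S) (V : TangentSpace IX P) : ℂ →L[ℝ] ℝ :=
  mfderiv IX 𝓘(ℝ, ℂ →L[ℝ] ℝ) (potH K) P V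

/-- The fibrewise symplectic form `ω_X = area + d (H β + κ)` on `X_H`. -/
def omegaH (K : Perturbation B T) (P : ℂ × S) (V W : TangentSpace IX P) : ℝ :=
  T.area P.2 (fibrePart V) (fibrePart W) + (dpotH K P V (basePart W) - dpotH K P W (basePart V))

/-- A vector at a point of `X_D` lies in the horizontal distribution: it is `ω_X`-orthogonal to all
vertical vectors. -/
def HorD (K : Perturbation B T) (P V : ℂ × ℝ × ℝ) : Prop :=
  ∀ W : ℂ × ℝ × ℝ, W.1 = 0 → omegaD K P V W = 0

/-- A vector at a point of `X_H` lies in the horizontal distribution. -/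
def HorH (K : Perturbation B T) (P : ℂ × S) (V : TangentSpace IX P) : Prop :=
  ∀ W : TangentSpace IX P, basePart W = 0 → omegaH K P V W = 0

/-! ### Almost complex structures -/

/-- The gluing map in the universal covering of `X_D`. -/
def glueCov (B : Base kind m n) (T : TwistSurface S) (P : ℂ × ℝ × ℝ) : ℂ × S := glue B T (cov P)

/-- A smooth almost complex structure on `X`. -/
structure ACS (B : Base kind m n) (T : TwistSurface S) where
  D : ℂ × ℝ × UnitAddCircle → (ℂ × ℝ × ℝ →L[ℝ] ℂ × ℝ × ℝ)
  H : ∀ P : ℂ × S, TangentSpace IX P →L[ℝ] TangentSpace IX P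
  D_smooth : ContDiffOn ℝ ∞ (fun P => D (cov P)) (cov ⁻¹' T.DSet)
  H_smooth : ContMDiffOn IX (IX.prod 𝓘(ℝ, (ℂ × E2) →L[ℝ] (ℂ × E2))) ∞
    (fun P => Bundle.TotalSpace.mk' ((ℂ × E2) →L[ℝ] (ℂ × E2))
      (E := fun P : ℂ × S => TangentSpace IX P →L[ℝ] TangentSpace IX P) P (H P)) T.HSet
  D_sq : ∀ P ∈ T.DSet, ∀ V, D P (D P V) = -V
  H_sq : ∀ P ∈ T.HSet, ∀ V, H P (H P V) = -V
  match_overlap : ∀ P : ℂ × ℝ × ℝ, cov P ∈ T.overlap → ∀ V : ℂ × ℝ × ℝ,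
    H (glueCov B T P) (mfderiv 𝓘(ℝ, ℂ × ℝ × ℝ) IX (glueCov B T) P V)
      = mfderiv 𝓘(ℝ, ℂ × ℝ × ℝ) IX (glueCov B T) P (D (cov P) V)

/-- Fibration-compatible almost complex structures: the projection is holomorphic, `J` is tamed by
`ω_X` on the fibres, and `J` preserves the horizontal distribution. -/
structure ACS.FibrationCompatible (J : ACS B T) (K : Perturbation B T) : Prop where
  projD : ∀ P ∈ T.DSet, ∀ V, (J.D P V).1 = Complex.I * V.1
  projH : ∀ P ∈ T.HSet, ∀ V, basePart (J.H P V) = Complex.I * basePart V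
  tameD : ∀ P : ℂ × ℝ × ℝ, cov P ∈ T.DSet → ∀ V : ℂ × ℝ × ℝ, V.1 = 0 → V ≠ 0 →
    0 < omegaD K P V (J.D (cov P) V)
  tameH : ∀ P ∈ T.HSet, ∀ V : TangentSpace IX P, basePart V = 0 → V ≠ 0 →
    0 < omegaH K P V (J.H P V)
  horD : ∀ P : ℂ × ℝ × ℝ, cov P ∈ T.DSet → ∀ V, HorD K P V → HorD K P (J.D (cov P) V)
  horH : ∀ P ∈ T.HSet, ∀ V, HorH K P V → HorH K P (J.H P V)

/-! ### Sections -/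

/-- Near `p`, the map `u` is `p' ↦ (p', ξ p', η p' mod 1) ∈ X_D`, with `ξ`, `η` smooth. -/
structure LocalD (u : B0 → TotalX B T) (p : B0) (ξ η : ℂ → ℝ) : Prop where
  smooth_x : ContDiffAt ℝ ∞ ξ p
  smooth_y : ContDiffAt ℝ ∞ η p
  eq_near : ∀ᶠ p' : B0 in 𝓝 p, ∃ h : cov ((p' : ℂ), ξ p', η p') ∈ T.DSet, u p' = inD B T ⟨_, h⟩

/-- Near `p`, the map `u` is `p' ↦ (p', f p') ∈ X_H`, with `f` smooth. -/
structure LocalH (u : B0 → TotalX B T) (p : B0) (f : ℂ → S) : Prop where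
  smooth : ContMDiffAt 𝓘(ℝ, ℂ) (𝓡∂ 2) ∞ f p
  eq_near : ∀ᶠ p' : B0 in 𝓝 p, ∃ h : ((p' : ℂ), f p') ∈ T.HSet, u p' = inH B T ⟨_, h⟩

/-- Smooth sections of `π : X → B_0`. -/
structure IsSmoothSection (u : B0 → TotalX B T) : Prop where
  proj_eq : ∀ p, proj B T (u p) = p
  smoothD : ∀ p, u p ∈ range (inD B T) → ∃ ξ η, LocalD u p ξ η
  smoothH : ∀ p, u p ∈ range (inH B T) → ∃ f, LocalH u p f

/-- The differential at `p` of the section `p' ↦ (p', ξ p', η p')` of `X_D`. -/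
def diffD (ξ η : ℂ → ℝ) (p : ℂ) (v : ℂ) : ℂ × ℝ × ℝ := (v, fderiv ℝ ξ p v, fderiv ℝ η p v)

/-- The differential at `p` of the section `p' ↦ (p', f p')` of `X_H`. -/
def diffH (f : ℂ → S) (p : ℂ) (v : ℂ) : TangentSpace IX (p, f p) :=
  mfderiv 𝓘(ℝ, ℂ) IX (fun p' : ℂ => (p', f p')) p v

/-- `u` is `J`-holomorphic: `du ∘ j_0 = J ∘ du`. -/
structure IsHolomorphic (J : ACS B T) (u : B0 → TotalX B T) : Prop where
  onD : ∀ p ξ η, LocalD u p ξ η → ∀ v : ℂ,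
    diffD ξ η p (Complex.I * v) = J.D (cov ((p : ℂ), ξ p, η p)) (diffD ξ η p v)
  onH : ∀ p f, LocalH u p f → ∀ v : ℂ,
    diffH f p (Complex.I * v) = J.H ((p : ℂ), f p) (diffH f p v)

/-- `u` is horizontal: the image of `du` is contained in the horizontal distribution. -/
structure IsHorizontal (K : Perturbation B T) (u : B0 → TotalX B T) : Prop where
  onD : ∀ p ξ η, LocalD u p ξ η → ∀ v : ℂ, HorD K ((p : ℂ), ξ p, η p) (diffD ξ η p v)
  onH : ∀ p f, LocalH u p f → ∀ v : ℂ, HorH K ((p : ℂ), f p) (diffH f p v)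

/-- The section `u` is transverse to `F_x`: at the points of intersection, each tangent vector of
`X` is the sum of a vector in the image of `du` and a vector tangent to `F_x`. -/
def IsTransverse (u : B0 → TotalX B T) (x : ℝ) : Prop :=
  ∀ p ξ η, LocalD u p ξ η → u p ∈ slice B T x →
    ∀ V : ℂ × ℝ × ℝ, ∃ (v : ℂ) (W : ℂ × ℝ × ℝ), W.2.1 = 0 ∧ V = diffD ξ η p v + W

/-! ### Homology classes -/

theorem half_mem (T : TwistSurface S) : (1 / 2 : ℝ) ∈ Ioo (-T.ε) (1 + T.ε) := by
  have := T.ε_pos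
  constructor <;> linarith

/-- The loop `y ↦ (p₀, 1 / 2, y)`, with base point `p₀ = -1`. -/
def yLoop (T : TwistSurface S) : C(unitInterval, T.DSet) where
  toFun t := ⟨(-1, 1 / 2, ((t : ℝ) : UnitAddCircle)), by
    refine ⟨⟨?_, ?_⟩, half_mem T⟩ <;> norm_num⟩
  continuous_toFun := by
    refine Continuous.subtype_mk (continuous_const.prodMk (continuous_const.prodMk ?_)) _
    exact (AddCircle.continuous_mk' 1).comp continuous_subtype_val

/-- The circle `t ↦ w = exp (-2 π i s t)` around a puncture of sign `s`. -/
def endCircle (s : ℝ) (t : ℝ) : ℂ := Complex.exp (((-(2 * Real.pi * s * t) : ℝ) : ℂ) * Complex.I)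

/-- The loop `t ↦ (p, 1 / 2, 0)`, where `p` runs over the circle `σ = 0` of a cylindrical end with
coordinates `(σ, t)`, in the direction of increasing `t`. -/
def endLoop (T : TwistSurface S) (s : ℝ) (c : ℂ → ℂ) (a : ℂ) (hc : IsDisc c a)
    (hm : ∀ w, w ≠ 0 → ‖w‖ ≤ 1 → c w ∈ B0set) : C(unitInterval, T.DSet) where
  toFun t := ⟨(c (endCircle s t), 1 / 2, 0), by
    refine ⟨hm _ (Complex.exp_ne_zero _) ?_, half_mem T⟩
    rw [endCircle, Complex.norm_exp_ofReal_mul_I]⟩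
  continuous_toFun := by
    refine Continuous.subtype_mk (Continuous.prodMk ?_ continuous_const) _
    refine hc.analytic.continuousOn.comp_continuous ?_ ?_
    · unfold endCircle
      fun_prop
    · intro t
      rw [mem_closedBall_zero_iff, endCircle, Complex.norm_exp_ofReal_mul_I]

theorem yLoop_closed (T : TwistSurface S) : yLoop T 0 = yLoop T 1 := by
  apply Subtype.ext
  have : (((1 : ℝ)) : UnitAddCircle) = 0 := AddCircle.coe_period 1
  simp [yLoop, this]

theorem endCircle_closed (kind : Kind) : endCircle kind.sign 0 = endCircle kind.sign 1 := by
  have h : Complex.exp (((2 * Real.pi : ℝ) : ℂ) * Complex.I) = 1 := by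
    push_cast
    exact Complex.exp_two_pi_mul_I
  have h' : Complex.exp (-(((2 * Real.pi : ℝ) : ℂ) * Complex.I)) = 1 := by
    rw [Complex.exp_neg, h, inv_one]
  cases kind
  · simp only [endCircle, Kind.sign]
    push_cast at h' ⊢
    simp only [mul_one, mul_zero, neg_zero, zero_mul, Complex.exp_zero, neg_mul]
    rw [h']
  · simp only [endCircle, Kind.sign]
    push_cast at h ⊢
    simp only [mul_one, mul_zero, neg_zero, zero_mul, Complex.exp_zero, mul_neg, neg_neg]
    rw [h]

theorem endLoop_closed (T : TwistSurface S) (kind : Kind) (c : ℂ → ℂ) (a : ℂ) (hc : IsDisc c a)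
    (hm : ∀ w, w ≠ 0 → ‖w‖ ≤ 1 → c w ∈ B0set) :
    endLoop T kind.sign c a hc hm 0 = endLoop T kind.sign c a hc hm 1 := by
  apply Subtype.ext
  have := endCircle_closed kind
  simp [endLoop, this]

/-- The class `p [S¹_y] + q₁ [S¹_{t₁}] + q₂ [S¹_{t₂}]` in `H_1(X_D)`. -/
def stdClass (B : Base kind m n) (T : TwistSurface S) (p q₁ q₂ : ℤ) : SingularH1.H1 T.DSet :=
  p • SingularH1.loopClass (yLoop T) (yLoop_closed T)
    + q₁ • SingularH1.loopClass (endLoop T kind.sign B.c₁ 0 B.disc₁ B.mem₁)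
        (endLoop_closed T kind B.c₁ 0 B.disc₁ B.mem₁)
    + q₂ • SingularH1.loopClass (endLoop T kind.sign B.c₂ 1 B.disc₂ B.mem₂)
        (endLoop_closed T kind B.c₂ 1 B.disc₂ B.mem₂)

/-- A parametrization of `C ∩ F_x`, where `C` is the image of the section `u`, by finitely many
pairwise disjoint, oriented, smoothly embedded circles. The projection of the `i`-th circle to
`B_0` is `γ i`, and the circle itself, as a loop in `X_D`, is `c i`. -/
structure CircleParam (u : B0 → TotalX B T) (x : ℝ) (k : ℕ) where
  γ : Fin k → ℝ → ℂ
  c : Fin k → C(unitInterval, T.DSet)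
  smooth : ∀ i, ContDiff ℝ ∞ (γ i)
  immersed : ∀ i t, deriv (γ i) t ≠ 0
  periodic : ∀ i t, γ i (t + 1) = γ i t
  embedded : ∀ i i' t t', t ∈ Ico (0 : ℝ) 1 → t' ∈ Ico (0 : ℝ) 1 → γ i t = γ i' t' →
    i = i' ∧ t = t'
  mem : ∀ i t, γ i t ∈ B0set
  image : ∀ p : B0, u p ∈ slice B T x ↔ ∃ i t, γ i t = p
  lift : ∀ i (t : unitInterval), inD B T (c i t) = u ⟨γ i t, mem i t⟩
  closed : ∀ i, c i 0 = c i 1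
  /-- The boundary orientation of `C ∩ F_{[x - ε', x]}` induced by `j_0`: an outward vector `w`
  (one along which the coordinate `x` increases), followed by the velocity of the circle, is a
  positively oriented pair. -/
  oriented : ∀ i t ξ η, LocalD u ⟨γ i t, mem i t⟩ ξ η → ∀ w : ℂ, 0 < fderiv ℝ ξ (γ i t) w →
    0 < ((starRingEnd ℂ) w * deriv (γ i) t).im

/-- The oriented intersection `C ∩ F_x` is a finite union of circles with homology class
`(p, q₁, q₂) ∈ H_1(X_D)`. -/
def HasSliceClass (u : B0 → TotalX B T) (x : ℝ) (p q₁ q₂ : ℤ) : Prop :=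
  ∃ (k : ℕ) (Γ : CircleParam u x k),
    ∑ i, SingularH1.loopClass (Γ.c i) (Γ.closed i) = stdClass B T p q₁ q₂

end Bundle

end DehnCobordism

end

open DehnCobordism

/-!
In the unperturbed range `κ` vanishes and `β = dg`, so the fibrewise symplectic form is
`dx ∧ (dy + x β)` and the horizontal distribution is the common kernel of `dx` and `α = dy + x β`
(`horD_iff`). As `J` preserves the horizontal distribution and covers `j_0`, the vertical part of
`du (i v)` is `J` applied to the vertical part of `du v`. Tameness on the fibres then gives
`(dx ∧ α)(du v, du (i v)) > 0` wherever `dx (du v) ≠ 0`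
(`ACS.FibrationCompatible.pos_of_dx_ne_zero`). At a point of the slice take `v = -i τ` with `τ` the
velocity of the oriented circle: `dx (du τ) = 0`, transversality gives `dx (du v) ≠ 0`, and the
boundary orientation makes it positive. Hence `α (du τ) > 0` (`CircleParam.form_pos`).

It remains to see that the integral of `dy + x dg` over a one-cycle in `X_D` of class `(p, q₁, q₂)`
is `p + x (m q₁ + n q₂)`. Integrals of `dθ` pulled back by a circle-valued map are replaced by
increments of continuous lifts to `ℝ`. These define a homomorphism on singular `H_1`, since lifts
exist over a `2`-simplex (`SingularH1.degree`). On the generators the degrees of `y` and `g` are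
computed in `degree_yMap_stdClass` and `degree_gMap_stdClass`; as `dg = k dt` is known only close to
a puncture, the circles around it are first shrunk (`degree_gMap_endLoop`). On a circle of the slice
the lift of `y + x g` has derivative `α (du τ) > 0`, so its increment is positive
(`CircleParam.degree_pos`), and there is at least one circle.
-/

/-! ### The degree pairing of first homology with a circle-valued map -/

namespace SingularH1

/-- A continuous circle-valued map on a nonempty convex set lifts to `ℝ`. -/
theorem exists_lift_of_convex {E : Type*} [NormedAddCommGroup E] [NormedSpace ℝ E] {s : Set E}
    (hs : Convex ℝ s) (hne : s.Nonempty) (f : C(s, UnitAddCircle)) :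
    ∃ F : C(s, ℝ), ∀ a, (F a : UnitAddCircle) = f a := by
  have := hs.contractibleSpace hne
  have := hs.locallyPathConnectedSpace
  obtain ⟨a₀, ha₀⟩ := hne
  obtain ⟨e₀, he₀⟩ := QuotientAddGroup.mk_surjective (f ⟨a₀, ha₀⟩)
  obtain ⟨F, ⟨-, hF⟩, -⟩ :=
    (AddCircle.isCoveringMap_coe (1 : ℝ)).existsUnique_continuousMap_lifts f ⟨a₀, ha₀⟩ e₀ he₀
  exact ⟨F, fun a => congrFun hF a⟩

/-- On a preconnected space, two lifts of the same circle-valued map have the same increments. -/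
theorem lift_sub_eq {A : Type*} [TopologicalSpace A] [PreconnectedSpace A] {F G : A → ℝ}
    (hF : Continuous F) (hG : Continuous G) (h : ∀ a, (F a : UnitAddCircle) = G a) (a b : A) :
    F b - F a = G b - G a := by
  have key : F = fun c => G c + (F a - G a) := by
    refine (AddCircle.isCoveringMap_coe (1 : ℝ)).eq_of_comp_eq hF (hG.add continuous_const) ?_ a ?_
    · funext c
      simp [h]
    · ring
  have := congrFun key b
  linarith

variable {Y : Type*} [TopologicalSpace Y]

theorem exists_simplex_lift (f : C(Y, UnitAddCircle)) {n : ℕ} (σ : Simplex n Y) :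
    ∃ F : C(stdSimplex ℝ (Fin (n + 1)), ℝ), ∀ a, (F a : UnitAddCircle) = f (σ a) :=
  exists_lift_of_convex (convex_stdSimplex ℝ (Fin (n + 1)))
    ⟨_, single_mem_stdSimplex ℝ (0 : Fin (n + 1))⟩ (f.comp σ)

/-- The increment of a lift of `f ∘ σ` to `ℝ` along a singular `1`-simplex `σ`. -/
noncomputable def increment (f : C(Y, UnitAddCircle)) (σ : Simplex 1 Y) : ℝ :=
  (exists_simplex_lift f σ).choose (stdSimplex.vertex 1)
    - (exists_simplex_lift f σ).choose (stdSimplex.vertex 0)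

theorem increment_eq (f : C(Y, UnitAddCircle)) (σ : Simplex 1 Y)
    {F : stdSimplex ℝ (Fin 2) → ℝ} (hF : Continuous F)
    (h : ∀ a, (F a : UnitAddCircle) = f (σ a)) :
    increment f σ = F (stdSimplex.vertex 1) - F (stdSimplex.vertex 0) :=
  lift_sub_eq (ContinuousMap.continuous _) hF
    (fun a => ((exists_simplex_lift f σ).choose_spec a).trans (h a).symm) _ _

/-- The real cochain `σ ↦ increment f σ`, representing `f^* dθ`. -/
noncomputable def incrementHom (f : C(Y, UnitAddCircle)) : Chain 1 Y →+ ℝ :=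
  Finsupp.liftAddHom fun σ => zmultiplesHom ℝ (increment f σ)

@[simp] theorem incrementHom_single (f : C(Y, UnitAddCircle)) (σ : Simplex 1 Y) (k : ℤ) :
    incrementHom f (Finsupp.single σ k) = k * increment f σ := by
  simp [incrementHom]

/-- The cochain is closed: a lift over a `2`-simplex restricts to lifts over its faces. -/
theorem incrementHom_boundary (f : C(Y, UnitAddCircle)) (τ : Chain 2 Y) :
    incrementHom f (boundary 1 Y τ) = 0 := by
  suffices (incrementHom f).comp (boundary 1 Y) = 0 from DFunLike.congr_fun this τ
  ext σ
  obtain ⟨F, hF⟩ := exists_simplex_lift f σ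
  have hi : ∀ i : Fin 3, increment f (σ.comp (face 1 i)) =
      F (stdSimplex.vertex (i.succAbove 1)) - F (stdSimplex.vertex (i.succAbove 0)) := by
    intro i
    rw [increment_eq f (σ.comp (face 1 i)) (F := fun a => F (face 1 i a)) (by fun_prop)
      (fun a => hF _)]
    simp only [face, ContinuousMap.coe_mk, stdSimplex.map_vertex]
  simp only [boundary, AddMonoidHom.comp_apply, Finsupp.singleAddHom_apply,
    Finsupp.liftAddHom_apply_single, zmultiplesHom_apply, one_smul, map_sum, incrementHom_single,
    hi, AddMonoidHom.zero_apply]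
  rw [Fin.sum_univ_three]
  simp [Fin.succAbove]

/-- The homomorphism `H_1(Y) → ℝ` given by pairing with `f^* dθ`. -/
noncomputable def degree (f : C(Y, UnitAddCircle)) : H1 Y →+ ℝ :=
  QuotientAddGroup.lift _ ((incrementHom f).comp (boundary 0 Y).ker.subtype) (by
    rintro ⟨z, hz⟩ ⟨τ, hτ⟩
    have : z = boundary 1 Y τ := hτ.symm
    subst this
    exact incrementHom_boundary f τ)

/-- On a loop, the degree is the increment of any lift. -/
theorem degree_loopClass (f : C(Y, UnitAddCircle)) (c : C(unitInterval, Y)) (h : c 0 = c 1)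
    {F : unitInterval → ℝ} (hF : Continuous F) (hFc : ∀ t, (F t : UnitAddCircle) = f (c t)) :
    degree f (loopClass c h) = F 1 - F 0 := by
  have : degree f (loopClass c h) = incrementHom f (Finsupp.single (pathSimplex c) 1) := rfl
  rw [this, incrementHom_single, Int.cast_one, one_mul,
    increment_eq f (pathSimplex c) (F := fun a => F (stdSimplexHomeomorphUnitInterval a))
      (hF.comp stdSimplexHomeomorphUnitInterval.continuous) (fun a => hFc _)]
  rfl

end SingularH1

namespace DehnCobordism

/-! ### Derivatives of lifts of circle-valued functions -/

theorem circleExp_coe (r : ℝ) :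
    circleExp (r : UnitAddCircle) = Complex.exp ((2 * Real.pi * r : ℝ) * Complex.I) := by
  rw [circleExp, AddCircle.toCircle_apply_mk, Circle.coe_exp, div_one]

theorem isOpen_B0set : IsOpen B0set :=
  isOpen_ne.inter isOpen_ne

/-- A continuous lift `G` of a circle-valued function along a curve has derivative the value of the
differential `circleForm f` on the velocity. -/
theorem hasDerivAt_lift {f : ℂ → UnitAddCircle} {γ : ℝ → ℂ} {γ' : ℂ} {G : ℝ → ℝ} {t : ℝ}
    (hf : DifferentiableAt ℝ (fun z => circleExp (f z)) (γ t)) (hγ : HasDerivAt γ γ' t)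
    (hG : ContinuousAt G t) (h : ∀ᶠ s in 𝓝 t, (G s : UnitAddCircle) = f (γ s)) :
    HasDerivAt G (circleForm f (γ t) γ') t := by
  set R : ℝ → ℂ := fun s => (starRingEnd ℂ) (circleExp (f (γ t))) * circleExp (f (γ s)) with hR
  have hRd : HasDerivAt R ((starRingEnd ℂ) (circleExp (f (γ t))) *
      fderiv ℝ (fun z => circleExp (f z)) (γ t) γ') t :=
    (hf.hasFDerivAt.comp_hasDerivAt t hγ).const_mul _
  have hRexp : ∀ᶠ s in 𝓝 t, R s = Complex.exp ((2 * Real.pi * (G s - G t) : ℝ) * Complex.I) := by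
    filter_upwards [h] with s hs
    rw [hR]
    simp only
    rw [← h.self_of_nhds, ← hs, circleExp_coe, circleExp_coe, ← Complex.exp_conj, ← Complex.exp_add]
    congr 1
    simp only [map_mul, Complex.conj_I, Complex.conj_ofReal]
    push_cast
    ring
  have hRt : R t = 1 := by
    rw [hRexp.self_of_nhds]
    simp
  -- Near `t` the principal branch of the logarithm recovers the lift.
  have hlog : ∀ᶠ s in 𝓝 t, G s = G t + (1 / (2 * Real.pi)) * (Complex.log (R s)).im := by
    have hclose : ∀ᶠ s in 𝓝 t, |G s - G t| < 1 / 2 := by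
      exact hG (Metric.ball_mem_nhds (G t) (by norm_num : (0 : ℝ) < 1 / 2))
    filter_upwards [hRexp, hclose] with s hs hc
    have hpi := Real.pi_pos
    rw [abs_lt] at hc
    rw [hs, Complex.log_exp]
    · rw [Complex.im_ofReal_mul, Complex.I_im]
      field_simp
      ring
    · rw [Complex.im_ofReal_mul, Complex.I_im]
      nlinarith
    · rw [Complex.im_ofReal_mul, Complex.I_im]
      nlinarith
  have hlogd := hRd.clog_real (by rw [hRt]; exact Complex.one_mem_slitPlane)
  have him := (Complex.imCLM.hasFDerivAt.comp_hasDerivAt t hlogd).const_mul (1 / (2 * Real.pi))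
  refine ((him.const_add (G t)).congr_of_eventuallyEq hlog).congr_deriv ?_
  rw [hRt]
  simp [circleForm]

/-- Two functions that agree modulo `1` near a point of continuity have the same derivative. -/
theorem hasDerivAt_of_coe_eq {F G : ℝ → ℝ} {F' t : ℝ} (hF : HasDerivAt F F' t)
    (hG : ContinuousAt G t) (h : ∀ᶠ s in 𝓝 t, (G s : UnitAddCircle) = F s) :
    HasDerivAt G F' t := by
  have hint : ∀ s, (G s : UnitAddCircle) = F s → ∃ k : ℤ, G s - F s = k := by
    intro s hs
    have : ((G s - F s : ℝ) : UnitAddCircle) = 0 := by rw [AddCircle.coe_sub, hs, sub_self]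
    obtain ⟨k, hk⟩ := (AddCircle.coe_eq_zero_iff (1 : ℝ)).1 this
    exact ⟨k, by simpa using hk.symm⟩
  obtain ⟨k₀, hk₀⟩ := hint t h.self_of_nhds
  have hclose := (hG.sub hF.continuousAt) (Metric.ball_mem_nhds (G t - F t) one_pos)
  have heq : ∀ᶠ s in 𝓝 t, G s = F s + k₀ := by
    filter_upwards [h, hclose] with s hs hc
    obtain ⟨k, hk⟩ := hint s hs
    have hc' : |G s - F s - (G t - F t)| < 1 := hc
    rw [hk, hk₀] at hc'
    have : k = k₀ := by
      have : |k - k₀| < 1 := by exact_mod_cast hc'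
      have := Int.abs_lt_one_iff.1 this
      omega
    subst this
    linarith
  exact (hF.add_const _).congr_of_eventuallyEq heq

variable {S : Type*} [TopologicalSpace S] [ChartedSpace (EuclideanHalfSpace 2) S]
  [IsManifold (𝓡∂ 2) ∞ S] {kind : Kind} {m n : ℕ}

theorem Base.differentiableAt_circleExp (B : Base kind m n) {z : ℂ} (hz : z ∈ B0set) :
    DifferentiableAt ℝ (fun z => circleExp (B.g z)) z :=
  (B.g_smooth.contDiffAt (isOpen_B0set.mem_nhds hz)).differentiableAt (by simp)

theorem Base.differentiableAt_β (B : Base kind m n) {z : ℂ} (hz : z ∈ B0set) :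
    DifferentiableAt ℝ B.β z := by
  have hE := B.g_smooth.contDiffAt (isOpen_B0set.mem_nhds hz)
  have hdE : DifferentiableAt ℝ (fderiv ℝ fun z' => circleExp (B.g z')) z :=
    (hE.fderiv_right (m := ∞) le_rfl).differentiableAt (by simp)
  have hconj : DifferentiableAt ℝ (fun z => (starRingEnd ℂ) (circleExp (B.g z))) z :=
    Complex.conjCLE.differentiableAt.comp z (B.differentiableAt_circleExp hz)
  have : DifferentiableAt ℝ (fun z => (starRingEnd ℂ) (circleExp (B.g z)) •
      fderiv ℝ (fun z' => circleExp (B.g z')) z) z := hconj.smul hdE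
  have hcomp := (ContinuousLinearMap.compL ℝ ℂ ℂ ℝ Complex.imCLM).differentiableAt.comp z this
  exact hcomp.const_smul (1 / (2 * Real.pi) : ℝ)

theorem Base.continuousOn_g (B : Base kind m n) : ContinuousOn B.g B0set := by
  have hE : ContinuousOn (fun z => AddCircle.toCircle (B.g z)) B0set :=
    Topology.IsEmbedding.subtypeVal.continuousOn_iff.2 B.g_smooth.continuousOn
  have := (AddCircle.homeomorphCircle (T := (1 : ℝ)) one_ne_zero).symm.continuous.comp_continuousOn
    hE
  refine this.congr fun z _ => ?_
  simp only [Function.comp]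
  rw [← AddCircle.homeomorphCircle_apply one_ne_zero, Homeomorph.symm_apply_apply]

/-! ### The horizontal distribution in the unperturbed range -/

variable {B : Base kind m n} {T : TwistSurface S} {K : Perturbation B T}

/-- Where `κ` vanishes, `x² / 2 β` has derivative `x β` in the direction of `∂_x`, and it is
constant in the direction of `∂_y`. -/
theorem fderiv_potD_vertical {P : ℂ × ℝ × ℝ} (hP : P.1 ∈ B0set)
    (hx : P.2.1 ∈ unperturbed T m n K.δ) {W : ℂ × ℝ × ℝ} (hW : W.1 = 0) :
    fderiv ℝ (potD K) P W = (P.2.1 * W.2.1) • B.β P.1 := by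
  have heq : potD K =ᶠ[𝓝 P] fun Q => (Q.2.1 ^ 2 / 2) • B.β Q.1 := by
    filter_upwards [K.D_supp P hP hx] with Q hQ
    rw [potD, hQ, add_zero]
  have h2 : HasFDerivAt (fun Q : ℂ × ℝ × ℝ => B.β Q.1)
      ((fderiv ℝ B.β P.1).comp (ContinuousLinearMap.fst ℝ ℂ (ℝ × ℝ))) P :=
    (B.differentiableAt_β hP).hasFDerivAt.comp P hasFDerivAt_fst
  have h1 : HasFDerivAt (fun Q : ℂ × ℝ × ℝ => Q.2.1)
      ((ContinuousLinearMap.fst ℝ ℝ ℝ).comp (ContinuousLinearMap.snd ℝ ℂ (ℝ × ℝ))) P :=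
    ((ContinuousLinearMap.fst ℝ ℝ ℝ).comp (ContinuousLinearMap.snd ℝ ℂ (ℝ × ℝ))).hasFDerivAt
  have h3 := ((h1.pow 2).mul_const (1 / 2 : ℝ)).smul h2
  have h4 : HasFDerivAt (potD K) _ P :=
    h3.congr_of_eventuallyEq (heq.trans (Eventually.of_forall fun Q => by simp [div_eq_mul_inv]))
  rw [h4.fderiv]
  simp [hW, smul_smul]

theorem omegaD_vertical {P : ℂ × ℝ × ℝ} (hP : P.1 ∈ B0set)
    (hx : P.2.1 ∈ unperturbed T m n K.δ) (V : ℂ × ℝ × ℝ) {W : ℂ × ℝ × ℝ} (hW : W.1 = 0) :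
    omegaD K P V W = V.2.1 * W.2.2 - (V.2.2 + P.2.1 * B.β P.1 V.1) * W.2.1 := by
  rw [omegaD, fderiv_potD_vertical hP hx hW, hW, map_zero]
  simp
  ring

/-- In the unperturbed range `ω_X = dx ∧ (dy + x β)`, so the horizontal distribution is the common
kernel of `dx` and `dy + x β`. -/
theorem horD_iff {P : ℂ × ℝ × ℝ} (hP : P.1 ∈ B0set)
    (hx : P.2.1 ∈ unperturbed T m n K.δ) (V : ℂ × ℝ × ℝ) :
    HorD K P V ↔ V.2.1 = 0 ∧ V.2.2 + P.2.1 * B.β P.1 V.1 = 0 := by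
  constructor
  · intro h
    have h1 := h (0, 0, 1) rfl
    have h2 := h (0, 1, 0) rfl
    rw [omegaD_vertical hP hx V rfl] at h1 h2
    simp at h1 h2
    exact ⟨h1, by linarith⟩
  · rintro ⟨h1, h2⟩ W hW
    rw [omegaD_vertical hP hx V hW, h1, h2]
    ring

/-- Positivity of `dx ∧ (dy + x β)` on the pair `V`, `J V` if `dx V ≠ 0`: the vertical part of `J V`
is `J` applied to the vertical part of `V`, and `J` is tamed on the fibre. -/
theorem ACS.FibrationCompatible.pos_of_dx_ne_zero {J : ACS B T} (hJ : J.FibrationCompatible K)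
    {P : ℂ × ℝ × ℝ} (hP : cov P ∈ T.DSet) (hx : P.2.1 ∈ unperturbed T m n K.δ)
    {V : ℂ × ℝ × ℝ} (hV : V.2.1 ≠ 0) :
    0 < V.2.1 * ((J.D (cov P) V).2.2 + P.2.1 * B.β P.1 (Complex.I * V.1))
      - (V.2.2 + P.2.1 * B.β P.1 V.1) * (J.D (cov P) V).2.1 := by
  have hz : P.1 ∈ B0set := hP.1
  -- the horizontal and the vertical part of `V`
  set L : ℂ × ℝ × ℝ := (V.1, 0, -(P.2.1 * B.β P.1 V.1)) with hL
  set A : ℂ × ℝ × ℝ := (0, V.2.1, V.2.2 + P.2.1 * B.β P.1 V.1) with hA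
  have hsum : V = A + L := by
    rw [hA, hL]
    ext <;> simp
  have hLhor : HorD K P L := (horD_iff hz hx L).2 (by simp [hL])
  have hJL := (horD_iff hz hx _).1 (hJ.horD P hP L hLhor)
  rw [hJ.projD _ hP] at hJL
  have hA1 : (J.D (cov P) A).1 = 0 := by rw [hJ.projD _ hP]; simp [hA]
  have hpos := hJ.tameD P hP A rfl (by
    intro h0
    exact hV (congrArg (fun W : ℂ × ℝ × ℝ => W.2.1) h0))
  rw [omegaD_vertical hz hx A hA1] at hpos
  have hJV : J.D (cov P) V = J.D (cov P) A + J.D (cov P) L := by rw [← map_add, ← hsum]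
  rw [hJV]
  simp only [hL, hA] at hJL hpos ⊢
  simp only [Prod.snd_add, Prod.fst_add, map_zero, mul_zero, add_zero] at hpos ⊢
  rw [hJL.1]
  have : ((J.D (cov P)) (V.1, 0, -(P.2.1 * B.β P.1 V.1))).2.2 =
    -(P.2.1 * B.β P.1 (Complex.I * V.1)) := by linarith [hJL.2]
  rw [this]
  linarith

/-! ### The degrees of the standard generators -/

/-- The coordinate `y : X_D → ℝ/ℤ`. -/
def yMap (T : TwistSurface S) : C(T.DSet, UnitAddCircle) where
  toFun P := P.1.2.2
  continuous_toFun := by fun_prop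

/-- The map `g`, pulled back to `X_D`. -/
def gMap (B : Base kind m n) (T : TwistSurface S) : C(T.DSet, UnitAddCircle) where
  toFun P := B.g P.1.1
  continuous_toFun := B.continuousOn_g.comp_continuous (by fun_prop) fun P => P.2.1

theorem hasDerivAt_endCircle (s t : ℝ) :
    HasDerivAt (endCircle s) (-(2 * Real.pi * s : ℝ) * Complex.I * endCircle s t) t := by
  have h : HasDerivAt (fun t : ℝ => -(2 * Real.pi * s * t)) (-(2 * Real.pi * s)) t := by
    exact ((hasDerivAt_id t).const_mul (2 * Real.pi * s)).neg.congr_deriv (by rw [mul_one])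
  convert! ((h.ofReal_comp).mul_const Complex.I).cexp using 1
  rw [endCircle]
  push_cast
  ring

theorem norm_endCircle (s t : ℝ) : ‖endCircle s t‖ = 1 := by
  rw [endCircle, Complex.norm_exp_ofReal_mul_I]

/-- The map `g` has degree `k` along the boundary circle of an end near whose puncture `dg = k dt`:
the degree is unchanged when the circle is shrunk towards the puncture. -/
theorem degree_gMap_endLoop (B : Base kind m n) (T : TwistSurface S) {c : ℂ → ℂ} {a : ℂ}
    (hc : IsDisc c a) (hm : ∀ w, w ≠ 0 → ‖w‖ ≤ 1 → c w ∈ B0set) {k : ℕ}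
    (hk : EqualsMulDtNear (circleForm B.g) c kind.sign k) :
    SingularH1.degree (gMap B T) (SingularH1.loopClass (endLoop T kind.sign c a hc hm)
      (endLoop_closed T kind c a hc hm)) = k := by
  set s := kind.sign with hs
  have hs2 : s * s = 1 := by
    rw [hs]
    cases kind <;> norm_num [Kind.sign]
  set w : ℝ → ℝ → ℂ := fun b t => (Real.exp (-b ^ 2) : ℂ) * endCircle s t with hw
  have hwn : ∀ b t, ‖w b t‖ = Real.exp (-b ^ 2) := by
    intro b t
    rw [hw]
    simp only
    rw [norm_mul, norm_endCircle, mul_one, Complex.norm_real, Real.norm_of_nonneg (Real.exp_pos _).le]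
  have hw0 : ∀ b t, w b t ≠ 0 := by
    intro b t
    rw [← norm_pos_iff, hwn]
    exact Real.exp_pos _
  have hw1 : ∀ b t, ‖w b t‖ ≤ 1 := by
    intro b t
    rw [hwn]
    exact Real.exp_le_one_iff.2 (by nlinarith [sq_nonneg b])
  have hwc : Continuous fun q : ℝ × ℝ => w q.1 q.2 := by
    rw [hw]
    unfold endCircle
    fun_prop
  have hcont : Continuous fun q : ℝ × ℝ => B.g (c (w q.1 q.2)) := by
    refine B.continuousOn_g.comp_continuous ?_ fun q => hm _ (hw0 _ _) (hw1 _ _)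
    exact hc.analytic.continuousOn.comp_continuous hwc fun q =>
      mem_closedBall_zero_iff.2 (hw1 _ _)
  -- lift the shrinking family of circles to `ℝ`
  obtain ⟨F, hF⟩ := SingularH1.exists_lift_of_convex (convex_univ (𝕜 := ℝ) (E := ℝ × ℝ))
    univ_nonempty ⟨fun q : (univ : Set (ℝ × ℝ)) => B.g (c (w q.1.1 q.1.2)),
      hcont.comp continuous_subtype_val⟩
  set G : ℝ → ℝ → ℝ := fun b t => F ⟨(b, t), mem_univ _⟩ with hG
  have hGg : ∀ b t, (G b t : UnitAddCircle) = B.g (c (w b t)) := fun b t => hF _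
  have hG1 : ∀ b, Continuous (G b) := fun b => by rw [hG]; fun_prop
  have hG2 : ∀ t, Continuous fun b => G b t := fun t => by rw [hG]; fun_prop
  have hper : ∀ b, w b 1 = w b 0 := fun b => by
    rw [hw]
    simp only
    rw [hs, endCircle_closed kind]
  have hdeg : SingularH1.degree (gMap B T) (SingularH1.loopClass (endLoop T s c a hc hm)
      (endLoop_closed T kind c a hc hm)) = G 0 1 - G 0 0 := by
    refine SingularH1.degree_loopClass (gMap B T) _ _ (F := fun t => G 0 t)
      ((hG1 0).comp continuous_subtype_val) fun t => ?_
    rw [hGg]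
    simp [hw, gMap, endLoop]
  rw [hdeg]
  obtain ⟨r, hr, hr'⟩ := Metric.eventually_nhds_iff.1 (eventually_nhdsWithin_iff.1 hk)
  obtain ⟨b, hb⟩ : ∃ b : ℝ, Real.exp (-b ^ 2) < r := by
    have : Tendsto (fun b : ℝ => Real.exp (-b ^ 2)) atTop (𝓝 0) :=
      Real.tendsto_exp_atBot.comp
        (tendsto_neg_atTop_atBot.comp (tendsto_pow_atTop two_ne_zero))
    exact (this.eventually (gt_mem_nhds hr)).exists
  have hconst : G b 1 - G 0 1 = G b 0 - G 0 0 :=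
    SingularH1.lift_sub_eq (hG2 1) (hG2 0) (fun b => by rw [hGg, hGg, hper]) 0 b
  -- close to the puncture the lift grows linearly, with slope `k`
  have hder : ∀ t, HasDerivAt (G b) k t := by
    intro t
    have hwd : HasDerivAt (w b) (-(2 * Real.pi * s : ℝ) * Complex.I * w b t) t := by
      refine ((hasDerivAt_endCircle s t).const_mul (Real.exp (-b ^ 2) : ℂ)).congr_deriv ?_
      rw [hw]
      ring
    have hcd : HasDerivAt c (deriv c (w b t)) (w b t) :=
      (hc.analytic _ (mem_closedBall_zero_iff.2 (hw1 b t))).differentiableAt.hasDerivAt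
    have hγ := HasDerivAt.comp t hcd hwd
    have hd := hasDerivAt_lift (B.differentiableAt_circleExp (hm _ (hw0 b t) (hw1 b t))) hγ
      (hG1 b).continuousAt (Eventually.of_forall fun s => hGg b s)
    refine hd.congr_deriv ?_
    have := hr' (y := w b t) (by rw [dist_zero_right, hwn]; exact hb) (hw0 b t)
      (-(2 * Real.pi * s : ℝ) * Complex.I * w b t)
    rw [Function.comp_apply, this, mul_div_cancel_right₀ _ (hw0 b t), ← Complex.ofReal_neg,
      Complex.im_ofReal_mul, Complex.I_im]
    have hpi := Real.pi_ne_zero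
    field_simp
    linear_combination (k : ℝ) * hs2
  have hder' : ∀ t, HasDerivAt (fun t => G b t - k * t) 0 t := fun t =>
    ((hder t).sub ((hasDerivAt_id t).const_mul (k : ℝ))).congr_deriv (by simp)
  have hlin := is_const_of_deriv_eq_zero (fun t => (hder' t).differentiableAt)
    (fun t => (hder' t).deriv) 1 0
  simp only [mul_one, mul_zero, sub_zero] at hlin
  linarith

theorem degree_yMap_stdClass (B : Base kind m n) (T : TwistSurface S) (p q₁ q₂ : ℤ) :
    SingularH1.degree (yMap T) (stdClass B T p q₁ q₂) = p := by
  have h0 : SingularH1.degree (yMap T) (SingularH1.loopClass (yLoop T) (yLoop_closed T)) = 1 := by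
    rw [SingularH1.degree_loopClass (yMap T) _ _ (F := fun t => (t : ℝ)) continuous_subtype_val
      (fun t => rfl)]
    simp
  have h1 : ∀ c a hc hm, SingularH1.degree (yMap T) (SingularH1.loopClass
      (endLoop T kind.sign c a hc hm) (endLoop_closed T kind c a hc hm)) = 0 := by
    intro c a hc hm
    rw [SingularH1.degree_loopClass (yMap T) _ _ (F := fun _ => 0) continuous_const
      (fun t => rfl), sub_zero]
  rw [stdClass, map_add, map_add, map_zsmul, map_zsmul, map_zsmul, h0, h1, h1]
  simp

theorem degree_gMap_stdClass (B : Base kind m n) (T : TwistSurface S) (p q₁ q₂ : ℤ) :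
    SingularH1.degree (gMap B T) (stdClass B T p q₁ q₂) = m * q₁ + n * q₂ := by
  obtain ⟨r, hr⟩ := QuotientAddGroup.mk_surjective (B.g (-1))
  have h0 : SingularH1.degree (gMap B T) (SingularH1.loopClass (yLoop T) (yLoop_closed T)) = 0 := by
    rw [SingularH1.degree_loopClass (gMap B T) _ _ (F := fun _ => r) continuous_const
      (fun t => hr), sub_self]
  rw [stdClass, map_add, map_add, map_zsmul, map_zsmul, map_zsmul, h0,
    degree_gMap_endLoop B T B.disc₁ B.mem₁ B.near₁, degree_gMap_endLoop B T B.disc₂ B.mem₂ B.near₂]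
  simp
  ring

/-! ### Positivity along the circles of the slice -/

theorem inD_injective (B : Base kind m n) (T : TwistSurface S) : Function.Injective (inD B T) :=
  fun _ _ h => Quotient.exact h

/-- Near an interior parameter `t`, a circle of the slice is the image of its projection `γ` under
the section, so its coordinates are given by a local representation `(ξ, η)` of the section. -/
theorem CircleParam.eventually_eq {u : B0 → TotalX B T} {x : ℝ} {k : ℕ} (Γ : CircleParam u x k)
    (i : Fin k) {t : ℝ} (ht : t ∈ Ioo (0 : ℝ) 1) {ξ η : ℂ → ℝ}
    (hloc : LocalD u ⟨Γ.γ i t, Γ.mem i t⟩ ξ η) :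
    ∀ᶠ s in 𝓝 t, ∃ hs : s ∈ Icc (0 : ℝ) 1,
      (Γ.c i ⟨s, hs⟩).1 = (Γ.γ i s, x, (η (Γ.γ i s) : UnitAddCircle)) ∧ ξ (Γ.γ i s) = x := by
  have hcont : Continuous fun s => (⟨Γ.γ i s, Γ.mem i s⟩ : B0) :=
    (Γ.smooth i).continuous.subtype_mk _
  filter_upwards [hcont.continuousAt.eventually hloc.eq_near, Icc_mem_nhds ht.1 ht.2] with s hs hsI
  obtain ⟨h, hu⟩ := hs
  have h1 : Γ.c i ⟨s, hsI⟩ = ⟨_, h⟩ := inD_injective B T ((Γ.lift i ⟨s, hsI⟩).trans hu)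
  have h2 : ξ (Γ.γ i s) = x := by
    obtain ⟨P, hPx, hP⟩ := (Γ.image ⟨Γ.γ i s, Γ.mem i s⟩).2 ⟨i, s, rfl⟩
    have := inD_injective B T (hP.trans hu)
    exact (congrArg (fun Q : T.DSet => Q.1.2.1) this).symm.trans hPx
  refine ⟨hsI, ?_, h2⟩
  rw [h1]
  simp only [cov, h2]

/-- The form `dy + x β` is positive on the velocity of a circle of the slice, which carries the
boundary orientation. -/
theorem CircleParam.form_pos {J : ACS B T} (hJ : J.FibrationCompatible K)
    {u : B0 → TotalX B T} (hhol : IsHolomorphic J u) {x : ℝ}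
    (hx : x ∈ unperturbed T m n K.δ) (htrans : IsTransverse u x) {k : ℕ} (Γ : CircleParam u x k)
    (i : Fin k) (t : ℝ) {ξ η : ℂ → ℝ} (hloc : LocalD u ⟨Γ.γ i t, Γ.mem i t⟩ ξ η)
    (hξ : ξ (Γ.γ i t) = x) (hdξ : fderiv ℝ ξ (Γ.γ i t) (deriv (Γ.γ i) t) = 0) :
    0 < fderiv ℝ η (Γ.γ i t) (deriv (Γ.γ i) t) + x * B.β (Γ.γ i t) (deriv (Γ.γ i) t) := by
  set z := Γ.γ i t
  set v := deriv (Γ.γ i) t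
  have hv : v ≠ 0 := Γ.immersed i t
  set w : ℂ := -Complex.I * v with hw
  have hIw : Complex.I * w = v := by rw [hw]; linear_combination -v * Complex.I_sq
  have hw0 : fderiv ℝ ξ z w ≠ 0 := by
    intro h0
    obtain ⟨a, W, hW, hV⟩ := htrans _ ξ η hloc ((Γ.image _).2 ⟨i, t, rfl⟩) (0, 1, 0)
    have h1 : fderiv ℝ ξ z a = 1 := by
      have := congrArg (fun P : ℂ × ℝ × ℝ => P.2.1) hV
      simp only [diffD, Prod.snd_add, Prod.fst_add, hW, add_zero] at this
      exact this.symm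
    have h2 : a = (a / v).re • v + (-(a / v).im) • w := by
      have : a = ((a / v).re + (a / v).im * Complex.I) * v := by
        rw [Complex.re_add_im, div_mul_cancel₀ _ hv]
      rw [hw, Complex.real_smul, Complex.real_smul]
      push_cast
      linear_combination this
    rw [h2, map_add, map_smul, map_smul, hdξ, h0] at h1
    simp at h1
  -- `-i v` points in the direction of increasing `x`, as the circle is oriented as a boundary
  have hwpos : 0 < fderiv ℝ ξ z w := by
    refine lt_of_le_of_ne (not_lt.1 fun hneg => ?_) hw0.symm
    have := Γ.oriented i t ξ η hloc (-w) (by rw [map_neg]; linarith)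
    have h2 : (starRingEnd ℂ) (-w) * v = -(Complex.I * ((starRingEnd ℂ) v * v)) := by
      rw [hw]
      simp [mul_assoc]
    change 0 < ((starRingEnd ℂ) (-w) * v).im at this
    rw [h2, mul_comm _ v, Complex.mul_conj] at this
    have h3 := Complex.normSq_pos.2 hv
    simp at this
    linarith
  obtain ⟨hP, -⟩ := hloc.eq_near.self_of_nhds
  have hpos := hJ.pos_of_dx_ne_zero (P := (z, ξ z, η z)) hP (by rw [hξ]; exact hx)
    (V := diffD ξ η z w) hw0
  have hol := hhol.onD _ ξ η hloc w
  change diffD ξ η z (Complex.I * w) = J.D (cov (z, ξ z, η z)) (diffD ξ η z w) at hol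
  rw [← hol, hIw] at hpos
  simp only [diffD, hIw, hdξ, mul_zero, sub_zero, hξ] at hpos
  exact (mul_pos_iff_of_pos_left hwpos).1 hpos

/-- The integral of `dy + x β` over each circle of the slice is positive. -/
theorem CircleParam.degree_pos {J : ACS B T} (hJ : J.FibrationCompatible K)
    {u : B0 → TotalX B T} (hu : IsSmoothSection u) (hhol : IsHolomorphic J u) {x : ℝ}
    (hx : x ∈ unperturbed T m n K.δ) (htrans : IsTransverse u x) {k : ℕ} (Γ : CircleParam u x k)
    (i : Fin k) :
    0 < SingularH1.degree (yMap T) (SingularH1.loopClass (Γ.c i) (Γ.closed i))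
      + x * SingularH1.degree (gMap B T) (SingularH1.loopClass (Γ.c i) (Γ.closed i)) := by
  obtain ⟨Y, hY⟩ := SingularH1.exists_lift_of_convex (convex_Icc (0 : ℝ) 1)
    (nonempty_Icc.2 zero_le_one) ((yMap T).comp (Γ.c i))
  obtain ⟨G, hG⟩ := SingularH1.exists_lift_of_convex (convex_Icc (0 : ℝ) 1)
    (nonempty_Icc.2 zero_le_one) ((gMap B T).comp (Γ.c i))
  rw [SingularH1.degree_loopClass (yMap T) _ _ Y.continuous hY,
    SingularH1.degree_loopClass (gMap B T) _ _ G.continuous hG]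
  set Y' : ℝ → ℝ := fun s => Y (projIcc 0 1 zero_le_one s) with hY'
  set G' : ℝ → ℝ := fun s => G (projIcc 0 1 zero_le_one s) with hG'
  have hY'c : Continuous Y' := Y.continuous.comp continuous_projIcc
  have hG'c : Continuous G' := G.continuous.comp continuous_projIcc
  have hmono : StrictMonoOn (fun s => Y' s + x * G' s) (Icc 0 1) := by
    refine strictMonoOn_of_deriv_pos (convex_Icc 0 1) (by fun_prop) fun t ht => ?_
    rw [interior_Icc] at ht
    have hslice := (Γ.image ⟨Γ.γ i t, Γ.mem i t⟩).2 ⟨i, t, rfl⟩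
    obtain ⟨ξ, η, hloc⟩ := hu.smoothD ⟨Γ.γ i t, Γ.mem i t⟩ (by
      obtain ⟨P, -, hP⟩ := hslice
      exact ⟨P, hP⟩)
    have hev := Γ.eventually_eq i ht hloc
    have hγ : HasDerivAt (Γ.γ i) (deriv (Γ.γ i) t) t :=
      ((Γ.smooth i).differentiable (by simp)).differentiableAt.hasDerivAt
    have hξd := (hloc.smooth_x.differentiableAt (by simp)).hasFDerivAt.comp_hasDerivAt t hγ
    have hηd := (hloc.smooth_y.differentiableAt (by simp)).hasFDerivAt.comp_hasDerivAt t hγ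
    have hdξ : fderiv ℝ ξ (Γ.γ i t) (deriv (Γ.γ i) t) = 0 := by
      refine hξd.unique ((hasDerivAt_const t x).congr_of_eventuallyEq ?_)
      filter_upwards [hev] with s hs
      exact hs.2.2
    have hYd : HasDerivAt Y' (fderiv ℝ η (Γ.γ i t) (deriv (Γ.γ i) t)) t := by
      refine hasDerivAt_of_coe_eq hηd hY'c.continuousAt ?_
      filter_upwards [hev] with s hs
      obtain ⟨hs, h1, -⟩ := hs
      rw [hY']
      simp only
      rw [projIcc_of_mem _ hs, hY]
      simp [yMap, h1]
    have hGd : HasDerivAt G' (B.β (Γ.γ i t) (deriv (Γ.γ i) t)) t := by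
      refine hasDerivAt_lift (B.differentiableAt_circleExp (Γ.mem i t)) hγ hG'c.continuousAt ?_
      filter_upwards [hev] with s hs
      obtain ⟨hs, h1, -⟩ := hs
      rw [hG']
      simp only
      rw [projIcc_of_mem _ hs, hG]
      simp [gMap, h1]
    have hd : HasDerivAt (fun s => Y' s + x * G' s) _ t := hYd.add (hGd.const_mul x)
    rw [hd.deriv]
    exact Γ.form_pos hJ hhol hx htrans i t hloc hev.self_of_nhds.2.2 hdξ
  have := hmono (left_mem_Icc.2 zero_le_one) (right_mem_Icc.2 zero_le_one) zero_lt_one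
  simp only [hY', hG', projIcc_left, projIcc_right] at this
  change Y 0 + x * G 0 < Y 1 + x * G 1 at this
  linarith

end DehnCobordism

theorem lemma3p2 {S : Type*} [TopologicalSpace S] [T2Space S] [CompactSpace S]
    [ChartedSpace (EuclideanHalfSpace 2) S] [IsManifold (𝓡∂ 2) ∞ S]
    {kind : Kind} {m n : ℕ} (hm : 0 < m) (hn : 0 < n)
    (B : Base kind m n) (T : TwistSurface S) (K : Perturbation B T)
    (J : ACS B T) (hJ : J.FibrationCompatible K)
    (u : B0 → TotalX B T) (hu : IsSmoothSection u) (hhol : IsHolomorphic J u)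
    (hhor : ¬ IsHorizontal K u)
    (x : ℝ) (hx : x ∈ unperturbed T m n K.δ)
    (htrans : IsTransverse u x) (hne : ∃ p, u p ∈ slice B T x)
    (p q₁ q₂ : ℤ) (hclass : HasSliceClass u x p q₁ q₂) :
    0 < (p : ℝ) + x * (m * q₁ + n * q₂) := by
  obtain ⟨k, Γ, hΓ⟩ := hclass
  rw [← degree_yMap_stdClass B T p q₁ q₂, ← degree_gMap_stdClass B T p q₁ q₂, ← hΓ, map_sum,
    map_sum, Finset.mul_sum, ← Finset.sum_add_distrib]
  obtain ⟨b, hb⟩ := hne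
  obtain ⟨i, -, -⟩ := (Γ.image b).1 hb
  exact Finset.sum_pos (fun i _ => Γ.degree_pos hJ hu hhol hx htrans i) ⟨i, Finset.mem_univ i⟩
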